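/- Let $d\ge 3$. For points $X_0,\dots,X_d\in\mathbb{R}^d$ write $|X_0X_1\cdots X_d|$ for the $d$-dimensional volume of their convex hull. Two non-degenerate simplexes $A_0A_1\cdots A_d$ and $A_{d+1}A_{d+2}\cdots A_{2d+1}$ in $\mathbb{R}^d$ are called reciprocal if $$|A_0\cdots A_d|\cdot|A_{d+1}\cdots A_{2d+1}|=\max_{j}\,|A_{j_0}\cdots A_{j_d}|\cdot|A_{j_{d+1}}\cdots A_{j_{2d+1}}|,$$ where the maximum is taken over all permutations $j$ of the indices $0,1,\dots,2d+1$. Let $\Sigma(A_0\cdots A_d)\subset(\mathbb{R}^d)^{d+1}$ be the set of all $(X_0,\dots,X_d)$ such that $X_0\cdots X_d$ is a simplex reciprocal to $A_0\cdots A_d$. For $0<w\le r$, a sphere shell of outer radius $r$ and thickness $w$ is a set $\Omega_*=\{x\in\mathbb{R}^d: r-w\le|x-c|\le r\}$ with $c\in\mathbb{R}^d$. There is a constant $C=C(d)>0$ such that for every sphere shell $\Omega_*$ of outer radius $r$ and thickness $w$, $0<w\le r$, and every non-degenerate simplex $A_0A_1\cdots A_d$ in $\mathbb{R}^d$, $$\int_{\Sigma(A_0\cdots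 A_d)\cap\Omega_*^{d+1}}\frac{dX_0\,dX_1\cdots dX_d}{|X_0X_1\cdots X_d|}\le C\,w^{d+1}r^{d^2-d-1}.$$ This bound is optimal up to a constant depending only on $d$: there is a constant $\kappa=\kappa(d)>0$ such that for every sphere shell $\Omega_*$ of outer radius $r$ and thickness $w$, $0<w\le r$, there is a non-degenerate simplex $A_0A_1\cdots A_d$ with vertices in $\Omega_*$ for which the integral above is at least $\kappa\,w^{d+1}r^{d^2-d-1}$. -/

import Mathlib

open MeasureTheory

noncomputable section

/-- The `d`-dimensional Lebesgue measure `|X₀ X₁ … X_d|` of the simplex in `ℝ^d` with vertices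
`X₀, …, X_d`. -/
def simplexVolume {d : ℕ} (X : Fin (d + 1) → EuclideanSpace ℝ (Fin d)) : ENNReal :=
  volume (convexHull ℝ (Set.range X))

/-- Two simplexes `A₀ … A_d` and `B₀ … B_d` in `ℝ^d` are reciprocal: the product of their volumes
is the maximum of the corresponding products, over all the permutations of the `2d + 2` points
`A₀, …, A_d, B₀, …, B_d`. -/
def AreReciprocal {d : ℕ} (A B : Fin (d + 1) → EuclideanSpace ℝ (Fin d)) : Prop :=
  AffineIndependent ℝ A ∧ AffineIndependent ℝ B ∧
    IsGreatest
      (Set.range fun σ : Equiv.Perm (Fin (d + 1) ⊕ Fin (d + 1)) =>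
        simplexVolume (fun i => Sum.elim A B (σ (Sum.inl i))) *
          simplexVolume (fun i => Sum.elim A B (σ (Sum.inr i))))
      (simplexVolume A * simplexVolume B)

/-- `Σ(A₀ … A_d) ⊆ (ℝ^d)^{d+1}`: the set of all simplexes reciprocal to `A₀ … A_d`. -/
def reciprocalRegion {d : ℕ} (A : Fin (d + 1) → EuclideanSpace ℝ (Fin d)) :
    Set (Fin (d + 1) → EuclideanSpace ℝ (Fin d)) :=
  {X | AreReciprocal A X}

/-- The closed sphere shell in `ℝ^d` with center `c`, outer radius `r` and thickness `w`. -/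
def sphereShell {d : ℕ} (c : EuclideanSpace ℝ (Fin d)) (r w : ℝ) :
    Set (EuclideanSpace ℝ (Fin d)) :=
  {x | r - w ≤ dist x c ∧ dist x c ≤ r}

/-- The integral of `1 / |X₀ … X_d|` over all simplexes reciprocal to `A₀ … A_d` whose vertices
lie in the sphere shell with center `c`, outer radius `r` and thickness `w`. -/
def reciprocalIntegral {d : ℕ} (A : Fin (d + 1) → EuclideanSpace ℝ (Fin d))
    (c : EuclideanSpace ℝ (Fin d)) (r w : ℝ) : ENNReal :=
  ∫⁻ X in reciprocalRegion A ∩ {X | ∀ i, X i ∈ sphereShell c r w}, (simplexVolume X)⁻¹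

end

/-! Upper bound. Exchanging `A i` with `X j` cannot increase the product of the volumes. The signed
volumes of the simplexes obtained from `A` by replacing one vertex with `X j` add up to that of `A`,
so dividing by `|A|` gives, for every `j`, 1/|X| ≤ ∑ᵢ 1/|X with `X j` replaced by `A i`|
(`AreReciprocal.inv_simplexVolume_le_sum`). The right side does not depend on `X j`. The geometric
mean of these `d + 1` bounds is a product of the kind the Loomis-Whitney inequality handles
(`loomis_whitney`). What remains is the integral of the power `-s` of the volume of a simplex with
one fixed vertex, where s = d/(d+1) < 1. Expanding the determinant one vertex at a time reduces it
to powers of affine functions (`lintegral_coordMinor_le`). These are integrated over the shell by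
Fubini: every hyperplane section of the shell has measure O(w r^(d-2)), which is where `d ≥ 3`
enters (`volume_sphereShell_section_le`).

Lower bound. Almost any 2d+2 points of the shell can be split into two reciprocal simplexes: take
the splitting with the largest product. By symmetry, reciprocal pairs fill at least the fraction
1/(2d+2)! of all pairs, so some `A` has at least that fraction of simplexes reciprocal to it. On all
of these, 1/|X| is at least a constant times r^(-d). -/

open scoped Pointwise

/-! ### Simplex volumes as determinants -/

/-- The matrix whose rows are the homogeneous coordinates `(1, X j)` of the points `X j`. -/
def homogeneousMatrix {d : ℕ} (X : Fin (d + 1) → EuclideanSpace ℝ (Fin d)) :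
    Matrix (Fin (d + 1)) (Fin (d + 1)) ℝ :=
  fun j => Fin.cons 1 (X j)

/-- The signed volume of the parallelepiped spanned by the simplex with vertices `X j`. -/
noncomputable def simplexDet {d : ℕ} (X : Fin (d + 1) → EuclideanSpace ℝ (Fin d)) : ℝ :=
  (homogeneousMatrix X).det

theorem abs_simplexDet_eq {d : ℕ} (j : Fin (d + 1))
    (X : Fin (d + 1) → EuclideanSpace ℝ (Fin d)) :
    |simplexDet X| = |Matrix.det fun i k : Fin d => X (j.succAbove i) k - X j k| := by
  classical
  let B : Matrix (Fin (d + 1)) (Fin (d + 1)) ℝ := fun i k =>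
    if i = j then homogeneousMatrix X j k
    else homogeneousMatrix X i k - homogeneousMatrix X j k
  have hB : (homogeneousMatrix X).det = B.det := by
    refine Matrix.det_eq_of_forall_row_eq_smul_add_const (fun i => if i = j then 0 else 1) j
      (by simp) fun i k => ?_
    by_cases h : i = j <;> simp [B, h]
  rw [simplexDet, hB, Matrix.det_succ_column B 0, Finset.sum_eq_single j]
  · have h1 : B j 0 = 1 := by simp [B, homogeneousMatrix]
    have h2 : B.submatrix j.succAbove (Fin.succAbove 0) =
        fun i k : Fin d => X (j.succAbove i) k - X j k := by
      ext i k
      rw [Matrix.submatrix_apply]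
      simp [B, homogeneousMatrix, Fin.succAbove_ne]
    rw [h1, h2, mul_one, abs_mul, abs_pow, abs_neg, abs_one, one_pow, one_mul]
  · intro i _ hi
    have : B i 0 = 0 := by simp [B, homogeneousMatrix, hi]
    simp [this]
  · simp

theorem homogeneousMatrix_update {d : ℕ} (X : Fin (d + 1) → EuclideanSpace ℝ (Fin d))
    (j : Fin (d + 1)) (p : EuclideanSpace ℝ (Fin d)) :
    homogeneousMatrix (Function.update X j p) =
      (homogeneousMatrix X).updateRow j (Fin.cons 1 p) := by
  ext i k
  by_cases h : i = j
  · subst h; simp [homogeneousMatrix]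
  · simp [homogeneousMatrix, Matrix.updateRow_ne h, Function.update_of_ne h]

/-- Cramer's rule: the determinants are the barycentric coordinates of `p`, multiplied by that of
`A`, and the column of ones records their sum. In adjugate form no nondegeneracy is needed. -/
theorem sum_simplexDet_update {d : ℕ} (A : Fin (d + 1) → EuclideanSpace ℝ (Fin d))
    (p : EuclideanSpace ℝ (Fin d)) :
    ∑ i, simplexDet (Function.update A i p) = simplexDet A := by
  have h := congrFun (Matrix.mulVec_cramer (homogeneousMatrix A).transpose (Fin.cons 1 p)) 0
  simp only [Matrix.mulVec, dotProduct, Matrix.transpose_apply, Matrix.cramer_transpose_apply,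
    Matrix.det_transpose, Pi.smul_apply, smul_eq_mul] at h
  simpa [simplexDet, homogeneousMatrix_update, homogeneousMatrix] using h

theorem affineIndependent_iff_simplexDet_ne_zero {d : ℕ}
    (X : Fin (d + 1) → EuclideanSpace ℝ (Fin d)) :
    AffineIndependent ℝ X ↔ simplexDet X ≠ 0 := by
  have h1 : simplexDet X ≠ 0 ↔ LinearIndependent ℝ (homogeneousMatrix X).row := by
    rw [Matrix.linearIndependent_rows_iff_isUnit, Matrix.isUnit_iff_isUnit_det, isUnit_iff_ne_zero,
      simplexDet]
  rw [h1, Fintype.linearIndependent_iff, affineIndependent_iff_of_fintype]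
  refine forall_congr' fun w => ?_
  have h2 : (∑ i, w i • (homogeneousMatrix X).row i = 0) ↔
      (∑ i, w i = 0 ∧ ∑ i, w i • X i = 0) := by
    rw [funext_iff, Fin.forall_fin_succ]
    refine and_congr ?_ ?_
    · simp [homogeneousMatrix, Matrix.row]
    · rw [PiLp.ext_iff]
      simp [homogeneousMatrix, Matrix.row]
  rw [h2, and_imp]
  refine forall_congr' fun hw => ?_
  rw [Finset.weightedVSub_eq_weightedVSubOfPoint_of_sum_eq_zero _ _ _ hw 0]
  simp

theorem continuous_simplexDet {d : ℕ} :
    Continuous (simplexDet : (Fin (d + 1) → EuclideanSpace ℝ (Fin d)) → ℝ) := by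
  refine Continuous.matrix_det (continuous_pi fun i => continuous_pi fun k => ?_)
  refine Fin.cases ?_ (fun k => ?_) k
  · simpa [homogeneousMatrix] using continuous_const
  · simp only [homogeneousMatrix, Fin.cons_succ]
    fun_prop

/-- The vertices `0, e₁, …, e_d` of the standard simplex. -/
noncomputable def standardVertices (d : ℕ) : Fin (d + 1) → EuclideanSpace ℝ (Fin d) :=
  Fin.cons 0 fun i => EuclideanSpace.single i 1

/-- The simplex is an affine image of the standard one. The volume of the latter is never computed;
only its being positive and finite matters. -/
theorem simplexVolume_eq {d : ℕ} (X : Fin (d + 1) → EuclideanSpace ℝ (Fin d)) :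
    simplexVolume X = ‖simplexDet X‖ₑ * simplexVolume (standardVertices d) := by
  let b := (EuclideanSpace.basisFun (Fin d) ℝ).toBasis
  let M : Matrix (Fin d) (Fin d) ℝ := fun k i => X i.succ k - X 0 k
  let L := Matrix.toLin b b M
  have hL : ∀ i, L (EuclideanSpace.single i 1) = X i.succ - X 0 := by
    intro i
    have : EuclideanSpace.single i 1 = b i := by simp [b]
    rw [this, Matrix.toLin_self]
    ext k
    simp [b, M, Pi.single_apply]
  have hX : Set.range X = X 0 +ᵥ L '' Set.range (standardVertices d) := by
    rw [← Set.range_comp, ← Set.image_vadd, ← Set.range_comp]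
    congr 1
    ext1 i
    refine Fin.cases ?_ (fun i => ?_) i
    · simp [standardVertices]
    · simp [standardVertices, hL]
  rw [simplexVolume, simplexVolume, hX, convexHull_vadd, ← LinearMap.image_convexHull,
    measure_vadd, Measure.addHaar_image_linearMap, LinearMap.det_toLin,
    ← Real.enorm_eq_ofReal_abs]
  congr 1
  have := abs_simplexDet_eq 0 X
  rw [← ofReal_norm, ← ofReal_norm, Real.norm_eq_abs, Real.norm_eq_abs, this,
    ← Matrix.det_transpose]
  rfl

theorem simplexVolume_standardVertices_ne_zero (d : ℕ) :
    simplexVolume (standardVertices d) ≠ 0 := by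
  have h : AffineIndependent ℝ (standardVertices d) := by
    rw [affineIndependent_iff_simplexDet_ne_zero, ← abs_ne_zero, abs_simplexDet_eq 0]
    have : (fun i k : Fin d => standardVertices d (Fin.succAbove 0 i) k - standardVertices d 0 k) =
        (1 : Matrix (Fin d) (Fin d) ℝ) := by
      ext i k
      simp [standardVertices, Matrix.one_apply, eq_comm]
    rw [this]
    simp
  refine (Measure.measure_pos_of_nonempty_interior _ ?_).ne'
  rw [interior_convexHull_nonempty_iff_affineSpan_eq_top,
    h.affineSpan_eq_top_iff_card_eq_finrank_add_one]
  simp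

theorem simplexVolume_ne_top {d : ℕ} (X : Fin (d + 1) → EuclideanSpace ℝ (Fin d)) :
    simplexVolume X ≠ ⊤ :=
  ((Set.finite_range X).isCompact_convexHull ℝ).measure_ne_top

theorem simplexVolume_ne_zero_iff {d : ℕ} (X : Fin (d + 1) → EuclideanSpace ℝ (Fin d)) :
    simplexVolume X ≠ 0 ↔ AffineIndependent ℝ X := by
  rw [simplexVolume_eq, affineIndependent_iff_simplexDet_ne_zero]
  simp [simplexVolume_standardVertices_ne_zero]

theorem measurable_simplexVolume {d : ℕ} :
    Measurable (simplexVolume : (Fin (d + 1) → EuclideanSpace ℝ (Fin d)) → ENNReal) := by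
  have : (simplexVolume : (Fin (d + 1) → EuclideanSpace ℝ (Fin d)) → ENNReal) =
      fun X => ‖simplexDet X‖ₑ * simplexVolume (standardVertices d) :=
    funext simplexVolume_eq
  rw [this]
  exact (continuous_simplexDet.measurable.enorm).mul_const _

theorem simplexVolume_le_sum_update {d : ℕ} (A : Fin (d + 1) → EuclideanSpace ℝ (Fin d))
    (p : EuclideanSpace ℝ (Fin d)) :
    simplexVolume A ≤ ∑ i, simplexVolume (Function.update A i p) := by
  rw [simplexVolume_eq A, Finset.sum_congr rfl fun i _ => simplexVolume_eq (Function.update A i p),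
    ← Finset.sum_mul]
  gcongr
  rw [← sum_simplexDet_update A p]
  exact enorm_sum_le _ _

/-! ### Exchanging one vertex between reciprocal simplexes -/

theorem AreReciprocal.update_mul_update_le {d : ℕ}
    {A X : Fin (d + 1) → EuclideanSpace ℝ (Fin d)} (h : AreReciprocal A X) (i j : Fin (d + 1)) :
    simplexVolume (Function.update A i (X j)) * simplexVolume (Function.update X j (A i)) ≤
      simplexVolume A * simplexVolume X := by
  refine h.2.2.2 ⟨Equiv.swap (Sum.inl i) (Sum.inr j), ?_⟩
  dsimp only
  congr 2 <;> ext1 k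
  · by_cases hk : k = i
    · simp [hk]
    · rw [Equiv.swap_apply_of_ne_of_ne (by simpa using hk) (by simp)]
      simp [hk]
  · by_cases hk : k = j
    · simp [hk]
    · rw [Equiv.swap_apply_of_ne_of_ne (by simp) (by simpa using hk)]
      simp [hk]

/-- Some exchange must keep a fair share of `|A|`, because the exchanged volumes sum to at least
`|A|`; reciprocity then forces the matching volume on the `X` side to be small. The gain is a bound
free of `X j`. -/
theorem AreReciprocal.inv_simplexVolume_le_sum {d : ℕ}
    {A X : Fin (d + 1) → EuclideanSpace ℝ (Fin d)} (h : AreReciprocal A X) (j : Fin (d + 1)) :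
    (simplexVolume X)⁻¹ ≤ ∑ i, (simplexVolume (Function.update X j (A i)))⁻¹ := by
  have hA := (simplexVolume_ne_zero_iff A).2 h.1
  have hX := (simplexVolume_ne_zero_iff X).2 h.2.1
  have hA' := simplexVolume_ne_top A
  have hX' := simplexVolume_ne_top X
  have h1 : ∀ i, simplexVolume (Function.update A i (X j)) ≤
      simplexVolume A * simplexVolume X * (simplexVolume (Function.update X j (A i)))⁻¹ := by
    intro i
    rw [← div_eq_mul_inv]
    refine (ENNReal.le_div_iff_mul_le (.inr ?_) (.inl (simplexVolume_ne_top _))).2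
      (h.update_mul_update_le i j)
    exact mul_ne_zero hA hX
  have h2 : simplexVolume A ≤ simplexVolume A * (simplexVolume X *
      ∑ i, (simplexVolume (Function.update X j (A i)))⁻¹) := by
    rw [← mul_assoc, Finset.mul_sum]
    exact (simplexVolume_le_sum_update A (X j)).trans (Finset.sum_le_sum fun i _ => h1 i)
  have h3 : 1 ≤ simplexVolume X * ∑ i, (simplexVolume (Function.update X j (A i)))⁻¹ := by
    by_contra! hlt
    exact absurd h2 (not_le.2 ((ENNReal.mul_lt_mul_iff_right hA hA').2 hlt |>.trans_eq (mul_one _)))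
  rw [ENNReal.inv_le_iff_le_mul (fun _ => hX) (fun h => absurd h hX')]
  exact h3

/-! ### The Loomis-Whitney inequality -/

theorem lintegral_pi_insertNth {α : Type*} [MeasurableSpace α] (ν : Measure α) [SigmaFinite ν]
    {n : ℕ} (j : Fin (n + 1)) {f : (Fin (n + 1) → α) → ENNReal} (hf : Measurable f) :
    ∫⁻ X, f X ∂Measure.pi (fun _ : Fin (n + 1) => ν) =
      ∫⁻ Y, ∫⁻ x, f (j.insertNth x Y) ∂ν ∂Measure.pi (fun _ : Fin n => ν) := by
  have h := (measurePreserving_piFinSuccAbove (fun _ : Fin (n + 1) => ν) j).symm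
  rw [← h.lintegral_comp hf, lintegral_prod_symm' (fun q => f ((MeasurableEquiv.piFinSuccAbove (fun _ => α) j).symm q))
    (hf.comp h.measurable)]
  rfl

theorem measurable_insertNth {α : Type*} [MeasurableSpace α] {n : ℕ} (j : Fin (n + 1)) :
    Measurable fun p : α × (Fin n → α) => (j.insertNth p.1 p.2 : Fin (n + 1) → α) :=
  (MeasurableEquiv.piFinSuccAbove (fun _ => α) j).symm.measurable

/-- The Loomis-Whitney inequality: if, for each `i`, the function `f (k i)` does not depend on the
variable `i`, then the integral of the product is at most a product of `L^p` norms, `p` being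
the number of the functions minus one. -/
theorem loomis_whitney {α : Type*} [MeasurableSpace α] (ν : Measure α) [IsFiniteMeasure ν]
    {p : ℕ} (hp : 0 < p) (n : ℕ) (k : Fin n → Fin (p + 1))
    (f : Fin (p + 1) → (Fin n → α) → ENNReal) (hf : ∀ j, Measurable (f j))
    (hk : ∀ i x y, f (k i) (Function.update x i y) = f (k i) x) :
    (ν Set.univ ^ (1 / p : ℝ)) ^ n *
        ∫⁻ x, ∏ j, f j x ^ (1 / p : ℝ) ∂Measure.pi (fun _ : Fin n => ν) ≤
      ∏ j, (∫⁻ x, f j x ∂Measure.pi (fun _ : Fin n => ν)) ^ (1 / p : ℝ) := by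
  have hp0 : (0 : ℝ) ≤ 1 / p := by positivity
  -- The number of variables decreases while all `p + 1` functions are kept; hence `n` is separate
  -- from `p` and `k` is arbitrary.
  induction n with
  | zero => simp [lintegral_unique]
  | succ n ih =>
    let g : Fin (p + 1) → (Fin n → α) → ENNReal := fun j y =>
      ∫⁻ x, f j ((0 : Fin (n + 1)).insertNth x y) ∂ν
    have hfi : ∀ j, Measurable fun q : α × (Fin n → α) => f j ((0 : Fin (n + 1)).insertNth q.1 q.2) :=
      fun j => (hf j).comp (measurable_insertNth 0)
    have hg : ∀ j, Measurable (g j) := fun j => (hfi j).lintegral_prod_left'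
    have hgk : ∀ i x y, g (k i.succ) (Function.update x i y) = g (k i.succ) x := by
      intro i x y
      refine lintegral_congr fun z => ?_
      rw [← hk i.succ ((0 : Fin (n + 1)).insertNth z x) y]
      simp
    have hprod : Measurable fun x : Fin (n + 1) → α => ∏ j, f j x ^ (1 / p : ℝ) :=
      Finset.measurable_prod _ fun j _ => (hf j).pow_const _
    have hfix : ∀ j y, Measurable fun x => f j ((0 : Fin (n + 1)).insertNth x y) :=
      fun j y => (hfi j).comp measurable_prodMk_right
    have hslice : ∀ y : Fin n → α, ν Set.univ ^ (1 / p : ℝ) *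
        ∫⁻ x, ∏ j, f j ((0 : Fin (n + 1)).insertNth x y) ^ (1 / p : ℝ) ∂ν ≤
          ∏ j, g j y ^ (1 / p : ℝ) := by
      intro y
      rcases isEmpty_or_nonempty α with hα | ⟨⟨x₀⟩⟩
      · have : ν = 0 := Measure.eq_zero_of_isEmpty ν
        simp [this]
      have hconst : ∀ x, f (k 0) ((0 : Fin (n + 1)).insertNth x y) =
          f (k 0) ((0 : Fin (n + 1)).insertNth x₀ y) := by
        intro x
        rw [← hk 0 _ x₀]
        simp
      have hgc : g (k 0) y = ν Set.univ * f (k 0) ((0 : Fin (n + 1)).insertNth x₀ y) := by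
        simp only [g, hconst, lintegral_const]
        rw [mul_comm]
      have hcard : (Finset.univ.erase (k 0)).card = p := by simp
      have hpR : (p : ℝ) ≠ 0 := by positivity
      -- Hölder for the `p` functions other than `f (k 0)`, whose exponents `1 / p` add up to one.
      -- The remaining factor is constant along the slice and absorbs the mass of `ν`.
      have hH := ENNReal.lintegral_prod_norm_pow_le (μ := ν) (Finset.univ.erase (k 0))
        (f := fun j x => f j ((0 : Fin (n + 1)).insertNth x y))
        (fun j _ => (hfix j y).aemeasurable) (p := fun _ => (1 / p : ℝ))
        (by rw [Finset.sum_const, hcard]; simp [hpR]) (fun _ _ => hp0)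
      simp_rw [← Finset.mul_prod_erase Finset.univ _ (Finset.mem_univ (k 0)), hconst]
      rw [lintegral_const_mul _ (Finset.measurable_prod _ fun j _ => (hfix j y).pow_const _),
        ← mul_assoc, ← ENNReal.mul_rpow_of_nonneg _ _ hp0, ← hgc]
      gcongr
    rw [lintegral_pi_insertNth ν 0 hprod, pow_succ, mul_assoc]
    simp_rw [fun j => lintegral_pi_insertNth ν 0 (hf j)]
    refine le_trans ?_ (ih (fun i => k i.succ) g hg hgk)
    gcongr
    rw [← lintegral_const_mul]
    · exact lintegral_mono hslice
    · exact (Finset.measurable_prod _ fun j _ => (hfi j).pow_const _).lintegral_prod_left'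

/-! ### Hyperplane sections of a sphere shell -/

theorem pow_sqrt_sub_pow_sqrt_le {n : ℕ} (hn : 2 ≤ n) {r w : ℝ} (hw : 0 ≤ w) (hwr : w ≤ r)
    (t : ℝ) :
    √(r ^ 2 - t ^ 2) ^ n - √((r - w) ^ 2 - t ^ 2) ^ n ≤ 2 * n * (w * r ^ (n - 1)) := by
  obtain ⟨m, rfl⟩ := Nat.exists_eq_add_of_le' hn
  have hr : 0 ≤ r := hw.trans hwr
  set p := √(r ^ 2 - t ^ 2) with hp
  set q := √((r - w) ^ 2 - t ^ 2) with hq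
  have hq0 : 0 ≤ q := Real.sqrt_nonneg _
  have hqp : q ≤ p := Real.sqrt_le_sqrt (by nlinarith)
  have hp0 : 0 ≤ p := hq0.trans hqp
  have hpr : p ≤ r := Real.sqrt_le_iff.2 ⟨hr, by nlinarith [sq_nonneg t]⟩
  have hsq : p ^ 2 - q ^ 2 ≤ 2 * r * w := by
    rcases le_or_gt (r ^ 2 - t ^ 2) 0 with h | h
    · have : p = 0 := Real.sqrt_eq_zero_of_nonpos h
      rw [this]
      nlinarith [sq_nonneg q, mul_nonneg hr hw]
    · have h1 : p ^ 2 = r ^ 2 - t ^ 2 := Real.sq_sqrt h.le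
      have h2 : (r - w) ^ 2 - t ^ 2 ≤ q ^ 2 := by
        rcases le_or_gt ((r - w) ^ 2 - t ^ 2) 0 with h' | h'
        · exact h'.trans (sq_nonneg _)
        · exact (Real.sq_sqrt h'.le).ge
      nlinarith
  have h1 : p ^ (m + 2) - q ^ (m + 2) ≤ (p - q) * (m + 2 : ℕ) * p ^ (m + 1) := by
    have h := abs_pow_sub_pow_le p q (m + 2)
    rw [abs_of_nonneg hp0, abs_of_nonneg hq0, max_eq_left hqp, abs_of_nonneg (sub_nonneg.2 hqp)] at h
    exact (le_abs_self _).trans h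
  refine h1.trans ?_
  -- Alone, `p - q` can be of order √(r w), near tangency to the inner sphere. The spare factor `p`,
  -- available because the exponent is at least 2, restores linearity in `w`.
  have h2 : (p - q) * p ≤ 2 * r * w := by nlinarith
  have h3 : p ^ m ≤ r ^ m := by gcongr
  calc (p - q) * (m + 2 : ℕ) * p ^ (m + 1) = (m + 2 : ℕ) * (((p - q) * p) * p ^ m) := by ring
    _ ≤ (m + 2 : ℕ) * ((2 * r * w) * r ^ m) := by gcongr
    _ = 2 * (m + 2 : ℕ) * (w * r ^ (m + 2 - 1)) := by
      rw [Nat.add_sub_assoc (by norm_num), show 2 - 1 = 1 from rfl]; ring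

/-- A section is an annulus. The convention that the square root of a negative number is 0 covers
hyperplanes missing one or both spheres. -/
theorem volume_sphereShell_section_le {n : ℕ} (hn : 2 ≤ n) {r w : ℝ} (hw : 0 ≤ w) (hwr : w ≤ r)
    (t : ℝ) :
    volume {y : EuclideanSpace ℝ (Fin n) |
        (r - w) ^ 2 ≤ t ^ 2 + ‖y‖ ^ 2 ∧ t ^ 2 + ‖y‖ ^ 2 ≤ r ^ 2} ≤
      ENNReal.ofReal (2 * n * (w * r ^ (n - 1))) *
        volume (Metric.ball (0 : EuclideanSpace ℝ (Fin n)) 1) := by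
  have : Nonempty (Fin n) := ⟨⟨0, by omega⟩⟩
  have hsub : {y : EuclideanSpace ℝ (Fin n) |
        (r - w) ^ 2 ≤ t ^ 2 + ‖y‖ ^ 2 ∧ t ^ 2 + ‖y‖ ^ 2 ≤ r ^ 2} ⊆
      Metric.closedBall 0 √(r ^ 2 - t ^ 2) \ Metric.ball 0 √((r - w) ^ 2 - t ^ 2) := by
    rintro y ⟨h1, h2⟩
    rw [Set.mem_sdiff, mem_closedBall_zero_iff, mem_ball_zero_iff, not_lt]
    exact ⟨Real.le_sqrt_of_sq_le (by linarith),
      Real.sqrt_le_iff.2 ⟨norm_nonneg _, by linarith⟩⟩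
  refine (measure_mono hsub).trans ?_
  rw [measure_sdiff _ Metric.isOpen_ball.measurableSet.nullMeasurableSet
      measure_ball_lt_top.ne,
    Measure.addHaar_closedBall _ _ (Real.sqrt_nonneg _),
    Measure.addHaar_ball _ _ (Real.sqrt_nonneg _), ← ENNReal.sub_mul, finrank_euclideanSpace_fin,
    ← ENNReal.ofReal_sub _ (by positivity)]
  · gcongr
    exact pow_sqrt_sub_pow_sqrt_le hn hw hwr t
  · exact fun _ _ => measure_ball_lt_top.ne
  · refine (Metric.ball_subset_ball (Real.sqrt_le_sqrt ?_)).trans Metric.ball_subset_closedBall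
    nlinarith

theorem mem_sphereShell_iff_sq {d : ℕ} {c x : EuclideanSpace ℝ (Fin d)} {r w : ℝ} (hw : 0 ≤ w)
    (hwr : w ≤ r) :
    x ∈ sphereShell c r w ↔ (r - w) ^ 2 ≤ ‖x - c‖ ^ 2 ∧ ‖x - c‖ ^ 2 ≤ r ^ 2 := by
  rw [sphereShell, Set.mem_ofPred_eq, dist_eq_norm,
    sq_le_sq₀ (sub_nonneg.2 hwr) (norm_nonneg _), sq_le_sq₀ (norm_nonneg _) (hw.trans hwr)]

theorem measurableSet_sphereShell {d : ℕ} (c : EuclideanSpace ℝ (Fin d)) (r w : ℝ) :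
    MeasurableSet (sphereShell c r w) := by
  have h : Measurable fun x : EuclideanSpace ℝ (Fin d) => dist x c := by fun_prop
  exact (measurableSet_le measurable_const h).inter (measurableSet_le h measurable_const)

/-- Coordinates centred at `c`, the first of them along the unit vector `u`. -/
theorem exists_measurePreserving_split {n : ℕ} (u c : EuclideanSpace ℝ (Fin (n + 1)))
    (hu : ‖u‖ = 1) :
    ∃ Φ : EuclideanSpace ℝ (Fin (n + 1)) → ℝ × EuclideanSpace ℝ (Fin n),
      MeasurePreserving Φ volume volume ∧ (∀ x, (Φ x).1 = inner ℝ u (x - c)) ∧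
        ∀ x, ‖x - c‖ ^ 2 = (Φ x).1 ^ 2 + ‖(Φ x).2‖ ^ 2 := by
  obtain ⟨b, hb⟩ := Orthonormal.exists_orthonormalBasis_extension_of_card_eq (𝕜 := ℝ)
    (E := EuclideanSpace ℝ (Fin (n + 1))) (ι := Fin (n + 1)) (by simp)
    (v := fun _ => u) (s := {0}) (by
      rw [orthonormal_iff_ite]
      rintro ⟨i, rfl⟩ ⟨j, rfl⟩
      simp [Set.domRestrict, hu])
  have hb0 : b 0 = u := hb 0 rfl
  have h1 : MeasurePreserving (fun x : EuclideanSpace ℝ (Fin (n + 1)) => x - c) volume volume :=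
    measurePreserving_sub_right volume c
  have h2 := ((PiLp.volume_preserving_ofLp (Fin (n + 1))).comp b.measurePreserving_repr).comp h1
  have h3 := (measurePreserving_piFinSuccAbove (fun _ : Fin (n + 1) => (volume : Measure ℝ)) 0).comp h2
  have h4 := ((MeasurePreserving.id (volume : Measure ℝ)).prod
    (PiLp.volume_preserving_toLp (Fin n))).comp h3
  refine ⟨_, h4, fun x => ?_, fun x => ?_⟩
  · simp [MeasurableEquiv.piFinSuccAbove, b.repr_apply_apply, hb0, inner_sub_right]
  · rw [← b.repr.norm_map, EuclideanSpace.norm_sq_eq, EuclideanSpace.norm_sq_eq, Fin.sum_univ_succ]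
    simp [MeasurableEquiv.piFinSuccAbove, Fin.tail]

theorem lintegral_sphereShell_inner_le {n : ℕ} (hn : 2 ≤ n) {r w : ℝ} (hw : 0 ≤ w) (hwr : w ≤ r)
    (u c : EuclideanSpace ℝ (Fin (n + 1))) (hu : ‖u‖ = 1) {g : ℝ → ENNReal} (hg : Measurable g) :
    ∫⁻ x in sphereShell c r w, g (inner ℝ u (x - c)) ≤
      ENNReal.ofReal (2 * n * (w * r ^ (n - 1))) *
        volume (Metric.ball (0 : EuclideanSpace ℝ (Fin n)) 1) * ∫⁻ t in Set.Icc (-r) r, g t := by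
  obtain ⟨Φ, hΦ, hΦ1, hΦ2⟩ := exists_measurePreserving_split u c hu
  let S : Set (ℝ × EuclideanSpace ℝ (Fin n)) :=
    {p | (r - w) ^ 2 ≤ p.1 ^ 2 + ‖p.2‖ ^ 2 ∧ p.1 ^ 2 + ‖p.2‖ ^ 2 ≤ r ^ 2}
  have hS : MeasurableSet S := by
    have h : Measurable fun p : ℝ × EuclideanSpace ℝ (Fin n) => p.1 ^ 2 + ‖p.2‖ ^ 2 := by fun_prop
    exact (measurableSet_le measurable_const h).inter (measurableSet_le h measurable_const)
  have hpre : sphereShell c r w = Φ ⁻¹' S := by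
    ext x
    rw [mem_sphereShell_iff_sq hw hwr, hΦ2]
    rfl
  have hgm : Measurable fun p : ℝ × EuclideanSpace ℝ (Fin n) => g p.1 := hg.comp measurable_fst
  simp_rw [← hΦ1]
  rw [hpre, hΦ.setLIntegral_comp_preimage hS hgm, ← lintegral_indicator hS, Measure.volume_eq_prod,
    lintegral_prod _ (hgm.indicator hS).aemeasurable, ← lintegral_indicator measurableSet_Icc,
    ← lintegral_const_mul _ (hg.indicator measurableSet_Icc)]
  refine lintegral_mono fun t => ?_
  have hsec : ∀ y : EuclideanSpace ℝ (Fin n), S.indicator (fun p => g p.1) (t, y) =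
      (Prod.mk t ⁻¹' S).indicator (fun _ => g t) y := fun y => rfl
  dsimp only
  simp_rw [hsec]
  rw [lintegral_indicator_const (measurable_prodMk_left hS)]
  by_cases ht : t ∈ Set.Icc (-r) r
  · rw [Set.indicator_of_mem ht, mul_comm]
    refine mul_le_mul_left ?_ _
    exact volume_sphereShell_section_le hn hw hwr t
  · have hempty : Prod.mk t ⁻¹' S = ∅ := by
      refine Set.eq_empty_of_forall_notMem fun y hy => ht ?_
      have h : t ^ 2 ≤ r ^ 2 := by have := hy.2; dsimp only at this; nlinarith [sq_nonneg ‖y‖]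
      exact abs_le.1 (abs_le_of_sq_le_sq h (hw.trans hwr))
    rw [hempty]
    simp

/-! ### Negative powers of affine functions -/

theorem lintegral_Ioc_rpow_neg {s : ℝ} (hs : s < 1) {r : ℝ} (hr : 0 ≤ r) :
    ∫⁻ t in Set.Ioc 0 r, ‖t‖ₑ ^ (-s) = ENNReal.ofReal (r ^ (1 - s) / (1 - s)) := by
  have h1 : ∫⁻ t in Set.Ioc 0 r, ‖t‖ₑ ^ (-s) = ∫⁻ t in Set.Ioc 0 r, ENNReal.ofReal (t ^ (-s)) := by
    refine setLIntegral_congr_fun measurableSet_Ioc fun t ht => ?_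
    rw [Real.enorm_of_nonneg ht.1.le, ENNReal.ofReal_rpow_of_pos ht.1]
  have hint : IntervalIntegrable (fun t : ℝ => t ^ (-s)) volume 0 r :=
    intervalIntegral.intervalIntegrable_rpow' (by linarith)
  rw [h1, ← ofReal_integral_eq_lintegral_ofReal]
  · rw [← intervalIntegral.integral_of_le hr, integral_rpow (.inl (by linarith)),
      Real.zero_rpow (by linarith)]
    congr 1
    ring_nf
  · exact (intervalIntegrable_iff_integrableOn_Ioc_of_le hr).1 hint
  · exact (ae_restrict_mem measurableSet_Ioc).mono fun t ht => Real.rpow_nonneg ht.1.le _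

/-- Uniformity in `b` is essential, since the zero of the affine function may lie anywhere. Where
`|t + b| ≤ r`, translation reduces to `b = 0`; elsewhere the integrand is at most `r ^ (-s)`. -/
theorem lintegral_Icc_rpow_neg_le {s : ℝ} (hs0 : 0 ≤ s) (hs : s < 1) {r : ℝ} (hr : 0 < r) (b : ℝ) :
    ∫⁻ t in Set.Icc (-r) r, ‖t + b‖ₑ ^ (-s) ≤
      ENNReal.ofReal ((2 + 2 / (1 - s)) * r ^ (1 - s)) := by
  have hball : ∫⁻ t in Set.Icc (-r) r, ‖t‖ₑ ^ (-s) ≤ ENNReal.ofReal (2 / (1 - s) * r ^ (1 - s)) := by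
    have hsub : Set.Icc (-r) r ⊆ Set.Icc (-r) 0 ∪ Set.Ioc 0 r := by
      rw [Set.Icc_union_Ioc_eq_Icc (by linarith) hr.le]
    have hneg : ∫⁻ t in Set.Icc (-r) 0, ‖t‖ₑ ^ (-s) = ∫⁻ t in Set.Ioc 0 r, ‖t‖ₑ ^ (-s) := by
      rw [setLIntegral_congr (Ioc_ae_eq_Icc (a := (0 : ℝ)) (b := r))]
      have h := (Measure.measurePreserving_neg (volume : Measure ℝ)).setLIntegral_comp_preimage
        (s := Set.Icc 0 r) measurableSet_Icc (f := fun t => ‖t‖ₑ ^ (-s)) (by fun_prop)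
      rw [← h]
      simp
    refine (lintegral_mono_set hsub).trans ((lintegral_union_le _ _ _).trans ?_)
    have h0 : 0 ≤ r ^ (1 - s) / (1 - s) := div_nonneg (by positivity) (by linarith)
    rw [hneg, lintegral_Ioc_rpow_neg hs hr.le, ← ENNReal.ofReal_add h0 h0]
    refine ENNReal.ofReal_le_ofReal (le_of_eq (by ring))
  have hpt : ∀ t : ℝ, ‖t + b‖ₑ ^ (-s) ≤
      (Set.Icc (-r) r).indicator (fun v : ℝ => ‖v‖ₑ ^ (-s)) (t + b) + ENNReal.ofReal (r ^ (-s)) := by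
    intro t
    by_cases h : t + b ∈ Set.Icc (-r) r
    · rw [Set.indicator_of_mem h]
      exact le_self_add
    · rw [Set.indicator_of_notMem h, zero_add, ← ENNReal.ofReal_rpow_of_pos hr]
      rw [ENNReal.rpow_neg, ENNReal.rpow_neg, ENNReal.inv_le_inv]
      refine ENNReal.rpow_le_rpow ?_ hs0
      rw [Real.enorm_eq_ofReal_abs]
      refine ENNReal.ofReal_le_ofReal (le_of_not_ge fun h' => h (abs_le.1 h'))
  refine (lintegral_mono fun t => hpt t).trans ?_
  rw [lintegral_add_right _ measurable_const, lintegral_const, Measure.restrict_apply_univ,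
    Real.volume_Icc, ← ENNReal.ofReal_mul (by positivity), sub_neg_eq_add]
  have h2 : ∫⁻ t in Set.Icc (-r) r, (Set.Icc (-r) r).indicator (fun v : ℝ => ‖v‖ₑ ^ (-s)) (t + b) ≤
      ∫⁻ t in Set.Icc (-r) r, ‖t‖ₑ ^ (-s) := by
    refine (setLIntegral_le_lintegral _ _).trans ?_
    rw [lintegral_add_right_eq_self
      (fun t => (Set.Icc (-r) r).indicator (fun v : ℝ => ‖v‖ₑ ^ (-s)) t) b,
      lintegral_indicator measurableSet_Icc]
  refine (add_le_add_left (h2.trans hball) _).trans ?_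
  have h0 : 0 ≤ 2 / (1 - s) * r ^ (1 - s) :=
    mul_nonneg (div_nonneg (by norm_num) (by linarith)) (by positivity)
  rw [← ENNReal.ofReal_add h0 (by positivity)]
  refine ENNReal.ofReal_le_ofReal (le_of_eq ?_)
  have : r ^ (1 - s) = r * r ^ (-s) := by
    rw [show 1 - s = 1 + -s by ring, Real.rpow_add hr, Real.rpow_one]
  rw [add_mul, this]
  ring

theorem enorm_rpow_neg_le_of_abs_le {s : ℝ} (hs : 0 ≤ s) {E F : Type*} [NormedAddCommGroup E]
    [NormedAddCommGroup F] {x : E} {y : F} (h : ‖x‖ ≤ ‖y‖) : ‖y‖ₑ ^ (-s) ≤ ‖x‖ₑ ^ (-s) := by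
  rw [ENNReal.rpow_neg, ENNReal.rpow_neg, ENNReal.inv_le_inv]
  exact ENNReal.rpow_le_rpow (enorm_le_iff_norm_le.2 h) hs

/-- An inverse power of an affine function is integrable over a sphere shell. -/
theorem exists_lintegral_sphereShell_affine_le {n : ℕ} (hn : 2 ≤ n) {s : ℝ} (hs0 : 0 < s)
    (hs : s < 1) :
    ∃ B : ℝ, 0 < B ∧ ∀ (c : EuclideanSpace ℝ (Fin (n + 1))) (r w : ℝ), 0 < w → w ≤ r →
      ∀ (v : EuclideanSpace ℝ (Fin (n + 1))) (b : ℝ),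
        ∫⁻ x in sphereShell c r w, ‖inner ℝ v x + b‖ₑ ^ (-s) ≤
          ‖v‖ₑ ^ (-s) * ENNReal.ofReal (B * (w * r ^ (n - 1) * r ^ (1 - s))) := by
  set V := volume (Metric.ball (0 : EuclideanSpace ℝ (Fin n)) 1) with hV
  obtain ⟨q, hq, hVq⟩ : ∃ q : ℝ, 0 < q ∧ V = ENNReal.ofReal q :=
    have hVtop : V ≠ ⊤ := measure_ball_lt_top.ne
    ⟨V.toReal, ENNReal.toReal_pos (Metric.measure_ball_pos _ _ one_pos).ne' hVtop,
      (ENNReal.ofReal_toReal hVtop).symm⟩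
  have hs1 : 0 < 1 - s := by linarith
  have hn0 : (0 : ℝ) < n := by exact_mod_cast (by omega : 0 < n)
  refine ⟨2 * n * q * (2 + 2 / (1 - s)), by positivity, fun c r w hw hwr v b => ?_⟩
  have hr : 0 < r := hw.trans_le hwr
  -- For `v = 0` the right side is infinite, a negative power of zero being `⊤`.
  rcases eq_or_ne v 0 with rfl | hv
  · rw [enorm_zero, ENNReal.zero_rpow_of_neg (by linarith), ENNReal.top_mul]
    · exact le_top
    · rw [ne_eq, ENNReal.ofReal_eq_zero, not_le]
      positivity
  have hv0 : 0 < ‖v‖ := norm_pos_iff.2 hv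
  set u := ‖v‖⁻¹ • v with hu
  have hu1 : ‖u‖ = 1 := by rw [hu, norm_smul, norm_inv, norm_norm, inv_mul_cancel₀ hv0.ne']
  set b' := (inner ℝ v c + b) / ‖v‖ with hb'
  have hfun : ∀ x, ‖inner ℝ v x + b‖ₑ ^ (-s) =
      ‖v‖ₑ ^ (-s) * ‖inner ℝ u (x - c) + b'‖ₑ ^ (-s) := by
    intro x
    have h1 : inner ℝ v x + b = ‖v‖ * (inner ℝ u (x - c) + b') := by
      rw [hu, hb', real_inner_smul_left, inner_sub_right]
      field_simp
      ring
    rw [h1, enorm_mul, enorm_norm, ENNReal.mul_rpow_of_ne_top enorm_ne_top enorm_ne_top]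
  simp_rw [hfun]
  rw [lintegral_const_mul _ (by fun_prop)]
  gcongr
  refine (lintegral_sphereShell_inner_le hn hw.le hwr u c hu1
    (g := fun t => ‖t + b'‖ₑ ^ (-s)) (by fun_prop)).trans ?_
  refine (mul_le_mul_right (lintegral_Icc_rpow_neg_le hs0.le hs hr b') _).trans ?_
  rw [← hV, hVq, ← ENNReal.ofReal_mul (by positivity),
    ← ENNReal.ofReal_mul (by positivity)]
  exact ENNReal.ofReal_le_ofReal (le_of_eq (by ring))

/-! ### Negative powers of minors and simplex volumes -/

/-- The determinant of the coordinates `e l` of the vectors `Y i - a`. -/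
noncomputable def coordMinor {n k : ℕ} (e : Fin k → Fin n) (a : EuclideanSpace ℝ (Fin n))
    (Y : Fin k → EuclideanSpace ℝ (Fin n)) : ℝ :=
  (Matrix.of fun i l => Y i (e l) - a (e l)).det

theorem measurable_coordMinor {n k : ℕ} (e : Fin k → Fin n) (a : EuclideanSpace ℝ (Fin n)) :
    Measurable (coordMinor e a) :=
  (Continuous.matrix_det (continuous_pi fun i => continuous_pi fun l => by fun_prop)).measurable

/-- An inverse power of a minor is integrable as soon as inverse powers of affine functions are. -/
theorem lintegral_coordMinor_le {n : ℕ} {s : ℝ} (hs : 0 ≤ s)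
    (ν : Measure (EuclideanSpace ℝ (Fin n))) [SigmaFinite ν] (K : ENNReal)
    (hK : ∀ v b, ∫⁻ x, ‖inner ℝ v x + b‖ₑ ^ (-s) ∂ν ≤ ‖v‖ₑ ^ (-s) * K)
    (a : EuclideanSpace ℝ (Fin n)) (k : ℕ) (e : Fin k → Fin n) (he : Function.Injective e) :
    ∫⁻ Y, ‖coordMinor e a Y‖ₑ ^ (-s) ∂Measure.pi (fun _ : Fin k => ν) ≤ K ^ k := by
  induction k with
  | zero => simp [lintegral_unique, coordMinor]
  | succ k ih =>
    rw [lintegral_pi_insertNth ν 0 ((measurable_coordMinor e a).enorm.pow_const _)]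
    have hslice : ∀ Y : Fin k → EuclideanSpace ℝ (Fin n),
        ∫⁻ x, ‖coordMinor e a ((0 : Fin (k + 1)).insertNth x Y)‖ₑ ^ (-s) ∂ν ≤
          ‖coordMinor (fun l => e l.succ) a Y‖ₑ ^ (-s) * K := by
      intro Y
      -- Expanded along its first row, the minor is affine in `x`, with a gradient `v` made of
      -- smaller minors. Its norm is at least any single entry; the entry at `e 0` leaves a minor to
      -- which induction applies.
      let m : Fin (k + 1) → ℝ := fun l =>
        (-1) ^ (l : ℕ) * coordMinor (fun l' => e (l.succAbove l')) a Y
      let v : EuclideanSpace ℝ (Fin n) := ∑ l, m l • EuclideanSpace.single (e l) 1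
      have hdet : ∀ x, coordMinor e a ((0 : Fin (k + 1)).insertNth x Y) =
          inner ℝ v x + -∑ l, m l * a (e l) := by
        intro x
        rw [coordMinor, Matrix.det_succ_row_zero]
        simp only [v, sum_inner, real_inner_smul_left, EuclideanSpace.inner_single_left]
        rw [← sub_eq_add_neg, ← Finset.sum_sub_distrib]
        refine Finset.sum_congr rfl fun l _ => ?_
        have hsub : ((Matrix.of fun i l : Fin (k + 1) =>
            ((0 : Fin (k + 1)).insertNth x Y : Fin (k + 1) → EuclideanSpace ℝ (Fin n)) i (e l) -
              a (e l)).submatrix Fin.succ l.succAbove).det =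
            coordMinor (fun l' => e (l.succAbove l')) a Y := by
          rw [coordMinor]
          congr 1
        rw [hsub]
        simp [m]
        ring
      have hv : v (e 0) = m 0 := by
        simp [v, Pi.single_apply, he.eq_iff]
      simp_rw [hdet]
      refine (hK _ _).trans (mul_le_mul_left (enorm_rpow_neg_le_of_abs_le hs ?_) _)
      have := PiLp.norm_apply_le v (e 0)
      rw [hv] at this
      simpa [m] using this
    refine (lintegral_mono hslice).trans ?_
    rw [lintegral_mul_const _ ((measurable_coordMinor _ a).enorm.pow_const _), pow_succ]
    gcongr
    exact ih (fun l => e l.succ) (he.comp (Fin.succ_injective _))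

theorem lintegral_simplexDet_insertNth_le {n : ℕ} {s : ℝ} (hs : 0 ≤ s)
    (ν : Measure (EuclideanSpace ℝ (Fin n))) [SigmaFinite ν] (K : ENNReal)
    (hK : ∀ v b, ∫⁻ x, ‖inner ℝ v x + b‖ₑ ^ (-s) ∂ν ≤ ‖v‖ₑ ^ (-s) * K)
    (a : EuclideanSpace ℝ (Fin n)) (j : Fin (n + 1)) :
    ∫⁻ Y, ‖simplexDet (j.insertNth a Y : Fin (n + 1) → EuclideanSpace ℝ (Fin n))‖ₑ ^ (-s)
      ∂Measure.pi (fun _ : Fin n => ν) ≤ K ^ n := by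
  refine le_trans (le_of_eq ?_) (lintegral_coordMinor_le hs ν K hK a n id Function.injective_id)
  refine lintegral_congr fun Y => ?_
  congr 1
  rw [Real.enorm_eq_ofReal_abs, Real.enorm_eq_ofReal_abs, abs_simplexDet_eq j, coordMinor]
  simp only [Fin.insertNth_apply_succAbove, Fin.insertNth_apply_same]
  rfl

theorem volume_sphereShell_ne_top {d : ℕ} (c : EuclideanSpace ℝ (Fin d)) (r w : ℝ) :
    volume (sphereShell c r w) ≠ ⊤ :=
  ((measure_mono fun _ hx => hx.2).trans_lt
    (measure_closedBall_lt_top (x := c) (r := r))).ne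

/-- This rests on (r-w)^(n+1) ≤ (r-w) r^n. -/
theorem le_volume_sphereShell {n : ℕ} (c : EuclideanSpace ℝ (Fin (n + 1))) {r w : ℝ}
    (hw : 0 < w) (hwr : w ≤ r) :
    ENNReal.ofReal (w * r ^ n) * volume (Metric.ball (0 : EuclideanSpace ℝ (Fin (n + 1))) 1) ≤
      volume (sphereShell c r w) := by
  have hr : 0 < r := hw.trans_le hwr
  have hrw : 0 ≤ r - w := sub_nonneg.2 hwr
  have hsub : Metric.closedBall c r \ Metric.ball c (r - w) ⊆ sphereShell c r w := by
    rintro x ⟨h1, h2⟩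
    rw [Metric.mem_ball, not_lt] at h2
    exact ⟨h2, h1⟩
  refine le_trans ?_ (measure_mono hsub)
  rw [measure_sdiff _ Metric.isOpen_ball.measurableSet.nullMeasurableSet measure_ball_lt_top.ne,
    Measure.addHaar_closedBall _ _ hr.le, Measure.addHaar_ball _ _ hrw, ← ENNReal.sub_mul,
    finrank_euclideanSpace_fin, ← ENNReal.ofReal_sub _ (by positivity)]
  · gcongr
    have h : (r - w) ^ n ≤ r ^ n := by gcongr; linarith
    have h' := mul_le_mul_of_nonneg_left h hrw
    rw [pow_succ, pow_succ]
    nlinarith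
  · exact fun _ _ => measure_ball_lt_top.ne
  · exact (Metric.ball_subset_ball (by linarith)).trans Metric.ball_subset_closedBall

theorem volume_sphereShell_ne_zero {n : ℕ} (c : EuclideanSpace ℝ (Fin (n + 1))) {r w : ℝ}
    (hw : 0 < w) (hwr : w ≤ r) : volume (sphereShell c r w) ≠ 0 := by
  have hr : 0 < r := hw.trans_le hwr
  refine (lt_of_lt_of_le (ENNReal.mul_pos ?_ ?_) (le_volume_sphereShell c hw hwr)).ne'
  · rw [ne_eq, ENNReal.ofReal_eq_zero, not_le]
    positivity
  · exact (Metric.measure_ball_pos _ _ one_pos).ne'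

theorem restrict_sphereShell_pi {d : ℕ} (ι : Type*) [Fintype ι] (c : EuclideanSpace ℝ (Fin d))
    (r w : ℝ) :
    (volume : Measure (ι → EuclideanSpace ℝ (Fin d))).restrict {X | ∀ i, X i ∈ sphereShell c r w} =
      Measure.pi fun _ => volume.restrict (sphereShell c r w) := by
  rw [← Measure.restrict_pi_pi]
  congr 1
  ext X
  simp

theorem lintegral_simplexVolume_update_le {n : ℕ} {s : ℝ} (hs : 0 ≤ s)
    (ν : Measure (EuclideanSpace ℝ (Fin n))) [IsFiniteMeasure ν] (K : ENNReal)
    (hK : ∀ v b, ∫⁻ x, ‖inner ℝ v x + b‖ₑ ^ (-s) ∂ν ≤ ‖v‖ₑ ^ (-s) * K)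
    (a : EuclideanSpace ℝ (Fin n)) (j : Fin (n + 1)) :
    ∫⁻ X, simplexVolume (Function.update X j a) ^ (-s)
      ∂Measure.pi (fun _ : Fin (n + 1) => ν) ≤
        simplexVolume (standardVertices n) ^ (-s) * (ν Set.univ * K ^ n) := by
  have hupd : Measurable fun X : Fin (n + 1) → EuclideanSpace ℝ (Fin n) => Function.update X j a :=
    measurable_update_left
  have hdet : Measurable fun Y : Fin n → EuclideanSpace ℝ (Fin n) =>
      ‖simplexDet (j.insertNth a Y : Fin (n + 1) → EuclideanSpace ℝ (Fin n))‖ₑ ^ (-s) :=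
    (continuous_simplexDet.measurable.comp
      ((measurable_insertNth j).comp measurable_prodMk_left)).enorm.pow_const _
  have hvol : Measurable fun X : Fin (n + 1) → EuclideanSpace ℝ (Fin n) =>
      simplexVolume (Function.update X j a) ^ (-s) :=
    (measurable_simplexVolume.comp hupd).pow_const _
  rw [lintegral_pi_insertNth ν j hvol]
  simp only [Fin.update_insertNth, lintegral_const]
  have h : ∀ Y : Fin n → EuclideanSpace ℝ (Fin n),
      simplexVolume (j.insertNth a Y : Fin (n + 1) → EuclideanSpace ℝ (Fin n)) ^ (-s) =
        simplexVolume (standardVertices n) ^ (-s) *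
        ‖simplexDet (j.insertNth a Y : Fin (n + 1) → EuclideanSpace ℝ (Fin n))‖ₑ ^ (-s) := by
    intro Y
    rw [simplexVolume_eq, mul_comm,
      ENNReal.mul_rpow_of_ne_top (simplexVolume_ne_top _) enorm_ne_top]
  simp_rw [h]
  rw [lintegral_mul_const _ (hdet.const_mul _), lintegral_const_mul _ hdet, mul_assoc,
    mul_comm _ (ν Set.univ)]
  gcongr
  exact lintegral_simplexDet_insertNth_le hs ν K hK a j

/-! ### The upper bound -/

theorem ENNReal.rpow_sum_le_sum_rpow {ι : Type*} (t : Finset ι) (f : ι → ENNReal) {p : ℝ}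
    (hp0 : 0 < p) (hp : p ≤ 1) : (∑ i ∈ t, f i) ^ p ≤ ∑ i ∈ t, f i ^ p :=
  Finset.le_sum_of_subadditive (fun x : ENNReal => x ^ p) (ENNReal.zero_rpow_of_pos hp0).le
    (fun x y => ENNReal.rpow_add_le_add_rpow x y hp0.le hp) t f

/-- The exponent s = d/(d+1) meets two needs: it is below 1, so the singularities are integrable,
and s · (1/d) · (d+1) = 1, so the Loomis-Whitney exponents `1 / d` recover the full power of
`1/|X|`. -/
theorem AreReciprocal.inv_simplexVolume_le_prod {d : ℕ} (hd : 0 < d)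
    {A X : Fin (d + 1) → EuclideanSpace ℝ (Fin d)} (h : AreReciprocal A X) :
    (simplexVolume X)⁻¹ ≤ ∏ j, (∑ i, simplexVolume (Function.update X j (A i)) ^
      (-(d / (d + 1) : ℝ))) ^ (1 / d : ℝ) := by
  have hd0 : (0 : ℝ) < d := by exact_mod_cast hd
  set s : ℝ := d / (d + 1) with hs
  have hs0 : 0 < s := by positivity
  have hs1 : s ≤ 1 := by rw [hs, div_le_one (by positivity)]; linarith
  have h1 : ∀ j, (simplexVolume X)⁻¹ ^ (1 / (d + 1) : ℝ) ≤
      (∑ i, simplexVolume (Function.update X j (A i)) ^ (-s)) ^ (1 / d : ℝ) := by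
    intro j
    have : (1 / (d + 1) : ℝ) = s * (1 / d) := by rw [hs]; field_simp
    rw [this, ENNReal.rpow_mul]
    refine ENNReal.rpow_le_rpow ?_ (by positivity)
    refine (ENNReal.rpow_le_rpow (h.inv_simplexVolume_le_sum j) hs0.le).trans ?_
    refine (ENNReal.rpow_sum_le_sum_rpow _ _ hs0 hs1).trans (le_of_eq ?_)
    simp_rw [ENNReal.inv_rpow, ENNReal.rpow_neg]
  refine le_trans (le_of_eq ?_) (Finset.prod_le_prod' fun j _ => h1 j)
  rw [Finset.prod_const, Finset.card_univ, Fintype.card_fin, ← ENNReal.rpow_natCast,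
    ← ENNReal.rpow_mul]
  have : 1 / ((d : ℝ) + 1) * ((d + 1 : ℕ) : ℝ) = 1 := by push_cast; field_simp
  rw [this, ENNReal.rpow_one]

theorem exists_reciprocalIntegral_le {n : ℕ} (hn : 2 ≤ n) :
    ∃ C : ℝ, 0 < C ∧
      ∀ (c : EuclideanSpace ℝ (Fin (n + 1))) (r w : ℝ), 0 < w → w ≤ r →
        ∀ A : Fin (n + 1 + 1) → EuclideanSpace ℝ (Fin (n + 1)),
          reciprocalIntegral A c r w ≤
            ENNReal.ofReal (C * (w ^ (n + 1 + 1) * r ^ ((n + 1) ^ 2 - (n + 1) - 1))) := by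
  set d := n + 1 with hd
  have hd0 : 0 < d := by omega
  have hdR : (0 : ℝ) < d := by exact_mod_cast hd0
  set s : ℝ := d / (d + 1) with hs
  have hs0 : 0 < s := by positivity
  have hs1 : s < 1 := by rw [hs, div_lt_one (by positivity)]; linarith
  obtain ⟨B, hB, hBle⟩ := exists_lintegral_sphereShell_affine_le hn hs0 hs1
  set V := simplexVolume (standardVertices d) with hV
  have hV0 : V ≠ 0 := simplexVolume_standardVertices_ne_zero d
  have hVtop : V ≠ ⊤ := simplexVolume_ne_top _
  set g : ENNReal := ((d + 1 : ℕ) * V ^ (-s)) ^ (1 / d : ℝ) with hg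
  have hVs : V ^ (-s) ≠ ⊤ := ENNReal.rpow_ne_top_of_ne_zero hV0 hVtop
  have hVs0 : V ^ (-s) ≠ 0 := by
    rw [ne_eq, ENNReal.rpow_eq_zero_iff]; simp [hV0, hVtop]
  obtain ⟨q, hq, hgq⟩ : ∃ q : ℝ, 0 < q ∧ g = ENNReal.ofReal q := by
    have htop : g ≠ ⊤ := ENNReal.rpow_ne_top_of_nonneg (by positivity)
      (ENNReal.mul_ne_top (ENNReal.natCast_ne_top _) hVs)
    refine ⟨g.toReal, ENNReal.toReal_pos ?_ htop, (ENNReal.ofReal_toReal htop).symm⟩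
    refine (ENNReal.rpow_pos (ENNReal.mul_pos ?_ hVs0) ?_).ne'
    · simp
    · exact ENNReal.mul_ne_top (ENNReal.natCast_ne_top _) hVs
  refine ⟨(q * B) ^ (d + 1), by positivity, fun c r w hw hwr A => ?_⟩
  have hr : 0 < r := hw.trans_le hwr
  set ν := (volume : Measure (EuclideanSpace ℝ (Fin d))).restrict (sphereShell c r w) with hν
  have hνu : ν Set.univ = volume (sphereShell c r w) := by rw [hν, Measure.restrict_apply_univ]
  have hm0 : ν Set.univ ≠ 0 := hνu ▸ volume_sphereShell_ne_zero c hw hwr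
  have hmtop : ν Set.univ ≠ ⊤ := hνu ▸ volume_sphereShell_ne_top c r w
  have : IsFiniteMeasure ν := ⟨hmtop.lt_top⟩
  set K : ENNReal := ENNReal.ofReal (B * (w * r ^ (n - 1) * r ^ (1 - s))) with hK
  let f : Fin (d + 1) → (Fin (d + 1) → EuclideanSpace ℝ (Fin d)) → ENNReal := fun j X =>
    ∑ i, simplexVolume (Function.update X j (A i)) ^ (-s)
  have hterm : ∀ i j, Measurable fun X : Fin (d + 1) → EuclideanSpace ℝ (Fin d) =>
      simplexVolume (Function.update X j (A i)) ^ (-s) := fun i j =>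
    (measurable_simplexVolume.comp measurable_update_left).pow_const _
  have hf : ∀ j, Measurable (f j) := fun j => Finset.measurable_sum _ fun i _ => hterm i j
  have hI : reciprocalIntegral A c r w ≤
      ∫⁻ X, ∏ j, f j X ^ (1 / d : ℝ) ∂Measure.pi fun _ : Fin (d + 1) => ν := by
    rw [hν, ← restrict_sphereShell_pi]
    refine (setLIntegral_mono (Finset.measurable_prod _ fun j _ => (hf j).pow_const _)
      fun X hX => ?_).trans (lintegral_mono_set Set.inter_subset_right)
    exact AreReciprocal.inv_simplexVolume_le_prod hd0 hX.1
  have hfint : ∀ j, ∫⁻ X, f j X ∂Measure.pi (fun _ : Fin (d + 1) => ν) ≤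
      ((d + 1 : ℕ) * V ^ (-s)) * (ν Set.univ * K ^ d) := by
    intro j
    rw [lintegral_finsetSum _ fun i _ => hterm i j]
    refine (Finset.sum_le_sum fun i _ => lintegral_simplexVolume_update_le hs0.le ν K
      (hBle c r w hw hwr) (A i) j).trans (le_of_eq ?_)
    rw [Finset.sum_const, Finset.card_univ, Fintype.card_fin, nsmul_eq_mul, mul_assoc]
  have hLW := loomis_whitney ν hd0 (d + 1) id f hf fun i x y => by simp [f]
  have hprod : ∏ j, (∫⁻ X, f j X ∂Measure.pi (fun _ : Fin (d + 1) => ν)) ^ (1 / d : ℝ) ≤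
      (ν Set.univ ^ (1 / d : ℝ)) ^ (d + 1) * (g * K) ^ (d + 1) := by
    refine (Finset.prod_le_prod' fun j _ =>
      ENNReal.rpow_le_rpow (hfint j) (by positivity)).trans (le_of_eq ?_)
    have hKd : (K ^ d) ^ (1 / d : ℝ) = K := by
      rw [← ENNReal.rpow_natCast, ← ENNReal.rpow_mul, mul_one_div_cancel hdR.ne', ENNReal.rpow_one]
    rw [Finset.prod_const, Finset.card_univ, Fintype.card_fin, ← mul_pow,
      ENNReal.mul_rpow_of_nonneg _ _ (by positivity), ← hg,
      ENNReal.mul_rpow_of_nonneg (ν Set.univ) _ (by positivity), hKd]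
    congr 1
    ring
  have hle := hLW.trans hprod
  -- The same power of the shell's volume stands on both sides and cancels, being positive and
  -- finite.
  rw [ENNReal.mul_le_mul_iff_right] at hle
  · refine (hI.trans hle).trans (le_of_eq ?_)
    rw [hgq, hK, ← ENNReal.ofReal_mul hq.le, ← ENNReal.ofReal_pow (by positivity)]
    congr 1
    -- Since 1 - s = 1/(d+1), the fractional powers of `r` combine to a single factor `r`.
    have hrs : (r ^ (1 - s)) ^ (d + 1) = r := by
      rw [← Real.rpow_natCast, ← Real.rpow_mul hr.le]
      have : (1 - s) * ((d + 1 : ℕ) : ℝ) = 1 := by rw [hs]; push_cast; field_simp; ring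
      rw [this, Real.rpow_one]
    have hexp : d ^ 2 - d - 1 = (n - 1) * (d + 1) + 1 := by
      obtain ⟨m, rfl⟩ := Nat.exists_eq_add_of_le' hn
      rw [hd, show m + 2 - 1 = m + 1 from rfl, Nat.sub_sub]
      refine Nat.sub_eq_of_eq_add ?_
      ring
    rw [hexp, pow_succ r, pow_mul, ← mul_assoc, mul_pow, mul_pow, mul_pow, hrs]
    ring
  · exact pow_ne_zero _ (ENNReal.rpow_pos (pos_iff_ne_zero.2 hm0) hmtop).ne'
  · exact ENNReal.pow_ne_top (ENNReal.rpow_ne_top_of_nonneg (by positivity) hmtop)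

/-! ### Reciprocal splittings of random points -/

theorem areReciprocal_iff {d : ℕ} (A X : Fin (d + 1) → EuclideanSpace ℝ (Fin d)) :
    AreReciprocal A X ↔ simplexVolume A ≠ 0 ∧ simplexVolume X ≠ 0 ∧
      ∀ σ : Equiv.Perm (Fin (d + 1) ⊕ Fin (d + 1)),
        simplexVolume (fun i => Sum.elim A X (σ (Sum.inl i))) *
          simplexVolume (fun i => Sum.elim A X (σ (Sum.inr i))) ≤
        simplexVolume A * simplexVolume X := by
  rw [AreReciprocal, simplexVolume_ne_zero_iff, simplexVolume_ne_zero_iff]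
  refine and_congr_right fun _ => and_congr_right fun _ => ⟨fun h σ => h.2 ⟨σ, rfl⟩, fun h => ?_⟩
  refine ⟨⟨1, rfl⟩, ?_⟩
  rintro _ ⟨σ, rfl⟩
  exact h σ

theorem measurableSet_areReciprocal (d : ℕ) :
    MeasurableSet {p : (Fin (d + 1) → EuclideanSpace ℝ (Fin d)) ×
      (Fin (d + 1) → EuclideanSpace ℝ (Fin d)) | AreReciprocal p.1 p.2} := by
  have hcoord : ∀ k : Fin (d + 1) ⊕ Fin (d + 1),
      Measurable fun p : (Fin (d + 1) → EuclideanSpace ℝ (Fin d)) ×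
        (Fin (d + 1) → EuclideanSpace ℝ (Fin d)) => Sum.elim p.1 p.2 k := by
    rintro (k | k)
    · exact (measurable_pi_apply k).comp measurable_fst
    · exact (measurable_pi_apply k).comp measurable_snd
  have hvol : ∀ g : Fin (d + 1) → Fin (d + 1) ⊕ Fin (d + 1),
      Measurable fun p : (Fin (d + 1) → EuclideanSpace ℝ (Fin d)) ×
        (Fin (d + 1) → EuclideanSpace ℝ (Fin d)) =>
          simplexVolume fun i => Sum.elim p.1 p.2 (g i) := fun g =>
    measurable_simplexVolume.comp (measurable_pi_iff.2 fun i => hcoord (g i))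
  simp_rw [areReciprocal_iff]
  refine ((hvol Sum.inl) (measurableSet_singleton 0).compl).inter
    (((hvol Sum.inr) (measurableSet_singleton 0).compl).inter ?_)
  refine MeasurableSet.congr (s := ⋂ σ : Equiv.Perm (Fin (d + 1) ⊕ Fin (d + 1)),
    {p : (Fin (d + 1) → EuclideanSpace ℝ (Fin d)) × (Fin (d + 1) → EuclideanSpace ℝ (Fin d)) |
      simplexVolume (fun i => Sum.elim p.1 p.2 (σ (Sum.inl i))) *
          simplexVolume (fun i => Sum.elim p.1 p.2 (σ (Sum.inr i))) ≤
        simplexVolume p.1 * simplexVolume p.2}) ?_ ?_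
  · exact MeasurableSet.iInter fun σ =>
      measurableSet_le ((hvol _).mul (hvol _)) ((hvol Sum.inl).mul (hvol Sum.inr))
  · ext p
    simp only [Set.mem_iInter]
    rfl

/-- Among the splittings of `2 d + 2` points into two simplexes, one consists of reciprocal
simplexes. -/
theorem exists_perm_areReciprocal {d : ℕ} (Z : Fin (d + 1) ⊕ Fin (d + 1) → EuclideanSpace ℝ (Fin d))
    (h1 : simplexVolume (fun i => Z (Sum.inl i)) ≠ 0)
    (h2 : simplexVolume (fun i => Z (Sum.inr i)) ≠ 0) :
    ∃ σ : Equiv.Perm (Fin (d + 1) ⊕ Fin (d + 1)),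
      AreReciprocal (fun i => Z (σ (Sum.inl i))) (fun i => Z (σ (Sum.inr i))) := by
  obtain ⟨σ, hσ⟩ := Finite.exists_max fun σ : Equiv.Perm (Fin (d + 1) ⊕ Fin (d + 1)) =>
    simplexVolume (fun i => Z (σ (Sum.inl i))) * simplexVolume (fun i => Z (σ (Sum.inr i)))
  have hne : simplexVolume (fun i => Z (σ (Sum.inl i))) *
      simplexVolume (fun i => Z (σ (Sum.inr i))) ≠ 0 :=
    ((ENNReal.mul_pos h1 h2).trans_le (hσ 1)).ne'
  have helim : Sum.elim (fun i => Z (σ (Sum.inl i))) (fun i => Z (σ (Sum.inr i))) =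
      fun k => Z (σ k) := by
    ext1 k
    cases k <;> rfl
  refine ⟨σ, (areReciprocal_iff _ _).2
    ⟨left_ne_zero_of_mul hne, right_ne_zero_of_mul hne, fun τ => ?_⟩⟩
  rw [helim]
  exact hσ (σ * τ)

/-- The power `-s` of the determinant has a finite integral, so it is finite almost everywhere. -/
theorem ae_simplexVolume_ne_zero {n : ℕ} {s : ℝ} (hs : 0 < s)
    (ν : Measure (EuclideanSpace ℝ (Fin n))) [IsFiniteMeasure ν] {K : ENNReal} (hKtop : K ≠ ⊤)
    (hK : ∀ v b, ∫⁻ x, ‖inner ℝ v x + b‖ₑ ^ (-s) ∂ν ≤ ‖v‖ₑ ^ (-s) * K) :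
    ∀ᵐ X ∂Measure.pi (fun _ : Fin (n + 1) => ν), simplexVolume X ≠ 0 := by
  have hm : Measurable fun X : Fin (n + 1) → EuclideanSpace ℝ (Fin n) => ‖simplexDet X‖ₑ ^ (-s) :=
    continuous_simplexDet.measurable.enorm.pow_const _
  have hfin : ∫⁻ X, ‖simplexDet X‖ₑ ^ (-s) ∂Measure.pi (fun _ : Fin (n + 1) => ν) ≠ ⊤ := by
    rw [lintegral_pi_insertNth ν 0 hm, lintegral_lintegral_swap]
    · refine ((lintegral_mono fun a =>
        lintegral_simplexDet_insertNth_le hs.le ν K hK a 0).trans_lt ?_).ne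
      rw [lintegral_const]
      exact ENNReal.mul_lt_top (ENNReal.pow_lt_top hKtop.lt_top) (measure_lt_top _ _)
    · exact (hm.comp ((measurable_insertNth 0).comp measurable_swap)).aemeasurable
  filter_upwards [ae_lt_top hm hfin] with X hX
  rw [simplexVolume_ne_zero_iff, affineIndependent_iff_simplexDet_ne_zero]
  intro h0
  rw [h0, enorm_zero, ENNReal.zero_rpow_of_neg (neg_lt_zero.2 hs)] at hX
  exact lt_irrefl _ hX

/-- Reciprocal pairs have positive proportion among all the pairs of independent random
simplexes. -/
theorem measure_univ_sq_le_measure_areReciprocal {d : ℕ}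
    (ν : Measure (EuclideanSpace ℝ (Fin d))) [IsFiniteMeasure ν]
    (hν : ∀ᵐ X ∂Measure.pi (fun _ : Fin (d + 1) => ν), simplexVolume X ≠ 0) :
    (Measure.pi (fun _ : Fin (d + 1) => ν) Set.univ) ^ 2 ≤
      Fintype.card (Equiv.Perm (Fin (d + 1) ⊕ Fin (d + 1))) *
        ((Measure.pi fun _ : Fin (d + 1) => ν).prod (Measure.pi fun _ : Fin (d + 1) => ν))
          {p | AreReciprocal p.1 p.2} := by
  set μ := Measure.pi fun _ : Fin (d + 1) => ν with hμ
  set R := {p : (Fin (d + 1) → EuclideanSpace ℝ (Fin d)) ×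
      (Fin (d + 1) → EuclideanSpace ℝ (Fin d)) | AreReciprocal p.1 p.2} with hR
  let P := Measure.pi fun _ : Fin (d + 1) ⊕ Fin (d + 1) => ν
  have hsplit : MeasurePreserving
      (fun Z : Fin (d + 1) ⊕ Fin (d + 1) → EuclideanSpace ℝ (Fin d) =>
        ((fun i => Z (Sum.inl i) : Fin (d + 1) → EuclideanSpace ℝ (Fin d)),
          (fun i => Z (Sum.inr i) : Fin (d + 1) → EuclideanSpace ℝ (Fin d)))) P (μ.prod μ) :=
    measurePreserving_sumPiEquivProdPi (fun _ : Fin (d + 1) ⊕ Fin (d + 1) => ν)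
  -- Permuting the points preserves `P`, so each splitting is reciprocal with the same probability.
  have hperm : ∀ σ : Equiv.Perm (Fin (d + 1) ⊕ Fin (d + 1)), MeasurePreserving
      (fun (Z : Fin (d + 1) ⊕ Fin (d + 1) → EuclideanSpace ℝ (Fin d)) k => Z (σ k)) P P := by
    intro σ
    have h := (measurePreserving_piCongrLeft (fun _ : Fin (d + 1) ⊕ Fin (d + 1) => ν) σ).symm
    exact h
  have hcomp := fun σ => hsplit.comp (hperm σ)
  have hae : ∀ᵐ Z ∂P, ∃ σ : Equiv.Perm (Fin (d + 1) ⊕ Fin (d + 1)),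
      AreReciprocal (fun i => Z (σ (Sum.inl i))) (fun i => Z (σ (Sum.inr i))) := by
    have h1 := (Measure.quasiMeasurePreserving_fst (μ := μ) (ν := μ)).comp
      hsplit.quasiMeasurePreserving |>.ae hν
    have h2 := (Measure.quasiMeasurePreserving_snd (μ := μ) (ν := μ)).comp
      hsplit.quasiMeasurePreserving |>.ae hν
    filter_upwards [h1, h2] with Z hZ1 hZ2 using exists_perm_areReciprocal Z hZ1 hZ2
  calc μ Set.univ ^ 2 = P Set.univ := by
        rw [sq, ← Measure.prod_prod, Set.univ_prod_univ,
          ← hsplit.measure_preimage MeasurableSet.univ.nullMeasurableSet, Set.preimage_univ]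
    _ = P (⋃ σ : Equiv.Perm (Fin (d + 1) ⊕ Fin (d + 1)),
          {Z | AreReciprocal (fun i => Z (σ (Sum.inl i))) (fun i => Z (σ (Sum.inr i)))}) := by
        refine measure_congr ?_
        filter_upwards [hae] with Z hZ
        exact propext ⟨fun _ => Set.mem_iUnion.2 hZ, fun _ => trivial⟩
    _ ≤ ∑ σ : Equiv.Perm (Fin (d + 1) ⊕ Fin (d + 1)),
          P {Z | AreReciprocal (fun i => Z (σ (Sum.inl i))) (fun i => Z (σ (Sum.inr i)))} :=
        measure_iUnion_fintype_le _ _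
    _ = ∑ _σ : Equiv.Perm (Fin (d + 1) ⊕ Fin (d + 1)), (μ.prod μ) R :=
        Finset.sum_congr rfl fun σ _ =>
          (hcomp σ).measure_preimage (measurableSet_areReciprocal d).nullMeasurableSet
    _ = _ := by rw [Finset.sum_const, Finset.card_univ, nsmul_eq_mul]

theorem measurableSet_reciprocalRegion {d : ℕ} (A : Fin (d + 1) → EuclideanSpace ℝ (Fin d)) :
    MeasurableSet (reciprocalRegion A) :=
  measurable_prodMk_left (measurableSet_areReciprocal d)

/-- Some simplex has a positive proportion of simplexes reciprocal to it. -/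
theorem exists_measure_univ_le_measure_reciprocalRegion {d : ℕ}
    (ν : Measure (EuclideanSpace ℝ (Fin d))) [IsFiniteMeasure ν] (hν0 : ν ≠ 0)
    (hν : ∀ᵐ X ∂Measure.pi (fun _ : Fin (d + 1) => ν), simplexVolume X ≠ 0)
    {p : (Fin (d + 1) → EuclideanSpace ℝ (Fin d)) → Prop}
    (hp : ∀ᵐ X ∂Measure.pi (fun _ : Fin (d + 1) => ν), p X) :
    ∃ A, p A ∧ AffineIndependent ℝ A ∧ Measure.pi (fun _ : Fin (d + 1) => ν) Set.univ ≤
      Fintype.card (Equiv.Perm (Fin (d + 1) ⊕ Fin (d + 1))) *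
        Measure.pi (fun _ : Fin (d + 1) => ν) (reciprocalRegion A) := by
  have hsq := measure_univ_sq_le_measure_areReciprocal ν hν
  set μ := Measure.pi fun _ : Fin (d + 1) => ν with hμ
  have hM0 : μ Set.univ ≠ 0 := by
    rw [hμ, Measure.pi_univ, Finset.prod_ne_zero_iff]
    exact fun _ _ => Measure.measure_univ_ne_zero.2 hν0
  have hMtop : μ Set.univ ≠ ⊤ := measure_ne_top _ _
  have hμ0 : μ ≠ 0 := Measure.measure_univ_ne_zero.1 hM0
  rw [Measure.prod_apply (measurableSet_areReciprocal d)] at hsq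
  have hint : ∫⁻ A, μ (reciprocalRegion A) ∂μ ≠ ⊤ := by
    refine ((lintegral_mono fun A => measure_mono (Set.subset_univ _)).trans_lt ?_).ne
    rw [lintegral_const]
    exact ENNReal.mul_lt_top hMtop.lt_top hMtop.lt_top
  -- A point where the section is at least average can be chosen off the null set where `p` fails.
  obtain ⟨A, hA, hle⟩ := exists_notMem_null_laverage_le hμ0 hint (ae_iff.1 hp)
  have hsec : μ Set.univ ≤
      Fintype.card (Equiv.Perm (Fin (d + 1) ⊕ Fin (d + 1))) * μ (reciprocalRegion A) := by
    rw [laverage_eq, ENNReal.div_le_iff hM0 hMtop] at hle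
    have h : μ Set.univ ^ 2 ≤ Fintype.card (Equiv.Perm (Fin (d + 1) ⊕ Fin (d + 1))) *
        (μ (reciprocalRegion A) * μ Set.univ) := hsq.trans (mul_le_mul_right hle _)
    rw [sq, ← mul_assoc] at h
    exact (ENNReal.mul_le_mul_iff_left hM0 hMtop).1 h
  refine ⟨A, not_not.1 hA, ?_, hsec⟩
  have hne : (reciprocalRegion A).Nonempty := by
    by_contra h
    rw [Set.not_nonempty_iff_eq_empty.1 h, measure_empty, mul_zero] at hsec
    exact hM0 (le_zero_iff.1 hsec)
  exact hne.some_mem.1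

/-! ### The lower bound -/

theorem simplexVolume_le_of_mem_sphereShell {d : ℕ} {X : Fin (d + 1) → EuclideanSpace ℝ (Fin d)}
    {c : EuclideanSpace ℝ (Fin d)} {r w : ℝ} (hr : 0 ≤ r) (hX : ∀ i, X i ∈ sphereShell c r w) :
    simplexVolume X ≤
      ENNReal.ofReal (r ^ d) * volume (Metric.ball (0 : EuclideanSpace ℝ (Fin d)) 1) := by
  have h : convexHull ℝ (Set.range X) ⊆ Metric.closedBall c r := by
    refine convexHull_min ?_ (convex_closedBall c r)
    rintro _ ⟨i, rfl⟩
    exact (hX i).2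
  refine (measure_mono h).trans (le_of_eq ?_)
  rw [Measure.addHaar_closedBall _ _ hr, finrank_euclideanSpace_fin]

theorem exists_le_reciprocalIntegral {n : ℕ} (hn : 2 ≤ n) :
    ∃ κ : ℝ, 0 < κ ∧
      ∀ (c : EuclideanSpace ℝ (Fin (n + 1))) (r w : ℝ), 0 < w → w ≤ r →
        ∃ A : Fin (n + 1 + 1) → EuclideanSpace ℝ (Fin (n + 1)), AffineIndependent ℝ A ∧
          (∀ i, A i ∈ sphereShell c r w) ∧
            ENNReal.ofReal (κ * (w ^ (n + 1 + 1) * r ^ ((n + 1) ^ 2 - (n + 1) - 1))) ≤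
              reciprocalIntegral A c r w := by
  set d := n + 1 with hd
  obtain ⟨q, hq, hVq⟩ : ∃ q : ℝ, 0 < q ∧
      volume (Metric.ball (0 : EuclideanSpace ℝ (Fin d)) 1) = ENNReal.ofReal q :=
    have htop : volume (Metric.ball (0 : EuclideanSpace ℝ (Fin d)) 1) ≠ ⊤ :=
      measure_ball_lt_top.ne
    ⟨_, ENNReal.toReal_pos (Metric.measure_ball_pos _ _ one_pos).ne' htop,
      (ENNReal.ofReal_toReal htop).symm⟩
  set N : ℕ := Fintype.card (Equiv.Perm (Fin (d + 1) ⊕ Fin (d + 1))) with hN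
  have hN0 : (0 : ℝ) < N := by exact_mod_cast Fintype.card_pos
  -- Any exponent strictly between 0 and 1 would do: it serves only to show that degenerate
  -- simplexes are negligible.
  obtain ⟨B, hB, hBle⟩ := exists_lintegral_sphereShell_affine_le hn (s := 1 / 2) (by norm_num)
    (by norm_num)
  -- This is the mass (w r^n q)^(d+1) / N of reciprocal simplexes divided by the volume bound r^d q.
  refine ⟨q ^ d / N, by positivity, fun c r w hw hwr => ?_⟩
  have hr : 0 < r := hw.trans_le hwr
  set ν := (volume : Measure (EuclideanSpace ℝ (Fin d))).restrict (sphereShell c r w) with hν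
  have hνu : ν Set.univ = volume (sphereShell c r w) := by rw [hν, Measure.restrict_apply_univ]
  have : IsFiniteMeasure ν := ⟨hνu ▸ (volume_sphereShell_ne_top c r w).lt_top⟩
  have hν0 : ν ≠ 0 :=
    Measure.measure_univ_ne_zero.1 (hνu ▸ volume_sphereShell_ne_zero c hw hwr)
  let T : Set (Fin (d + 1) → EuclideanSpace ℝ (Fin d)) := {X | ∀ i, X i ∈ sphereShell c r w}
  have hT : MeasurableSet T := by
    have : T = Set.univ.pi fun _ => sphereShell c r w := by ext X; simp [T]
    rw [this]
    exact MeasurableSet.univ_pi fun _ => measurableSet_sphereShell c r w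
  have hpi : volume.restrict T = Measure.pi fun _ : Fin (d + 1) => ν :=
    restrict_sphereShell_pi (Fin (d + 1)) c r w
  obtain ⟨A, hAT, hA, hle⟩ := exists_measure_univ_le_measure_reciprocalRegion ν hν0
    (ae_simplexVolume_ne_zero (by norm_num) ν ENNReal.ofReal_ne_top (hBle c r w hw hwr))
    (p := fun X => X ∈ T) (by rw [← hpi]; exact ae_restrict_mem hT)
  refine ⟨A, hA, hAT, ?_⟩
  have hS := measurableSet_reciprocalRegion A
  have hI : (ENNReal.ofReal (r ^ d * q))⁻¹ *
      Measure.pi (fun _ : Fin (d + 1) => ν) (reciprocalRegion A) ≤ reciprocalIntegral A c r w := by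
    rw [← hpi, Measure.restrict_apply hS, ← setLIntegral_const]
    refine setLIntegral_mono' (hS.inter hT) fun X hX => ENNReal.inv_le_inv.2 ?_
    rw [ENNReal.ofReal_mul (by positivity), ← hVq]
    exact simplexVolume_le_of_mem_sphereShell hr.le hX.2
  have hM : ENNReal.ofReal ((w * r ^ n * q) ^ (d + 1)) ≤
      Measure.pi (fun _ : Fin (d + 1) => ν) Set.univ := by
    rw [Measure.pi_univ, Finset.prod_const, Finset.card_univ, Fintype.card_fin, hνu,
      ENNReal.ofReal_pow (by positivity), ENNReal.ofReal_mul (by positivity), ← hVq]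
    gcongr
    exact le_volume_sphereShell c hw hwr
  have hdiv : ENNReal.ofReal ((w * r ^ n * q) ^ (d + 1) / N) ≤
      Measure.pi (fun _ : Fin (d + 1) => ν) (reciprocalRegion A) := by
    rw [ENNReal.ofReal_div_of_pos hN0, ENNReal.ofReal_natCast]
    exact ENNReal.div_le_of_le_mul' (hM.trans hle)
  refine le_trans (le_of_eq ?_) ((mul_le_mul_right hdiv _).trans hI)
  rw [← ENNReal.ofReal_inv_of_pos (by positivity), ← ENNReal.ofReal_mul (by positivity)]
  congr 1
  have hexp : n * (d + 1) = (d ^ 2 - d - 1) + d := by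
    obtain ⟨m, rfl⟩ := Nat.exists_eq_add_of_le' hn
    have h : d ^ 2 - d - 1 = (m + 1) * (d + 1) + 1 := by
      rw [hd, Nat.sub_sub]
      refine Nat.sub_eq_of_eq_add ?_
      ring
    rw [h, hd]
    ring
  have hcancel : ∀ k m : ℕ, q ^ m / N * (w ^ (m + 1) * r ^ k) =
      (r ^ m * q)⁻¹ * (w ^ (m + 1) * (r ^ k * r ^ m) * (q ^ m * q) / N) := by
    intro k m
    field_simp
  rw [mul_pow, mul_pow, ← pow_mul, hexp, pow_add r (d ^ 2 - d - 1) d, pow_succ q d]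
  exact hcancel _ _

theorem theorem1 (d : ℕ) (hd : 3 ≤ d) :
    (∃ C : ℝ, 0 < C ∧
      ∀ (c : EuclideanSpace ℝ (Fin d)) (r w : ℝ), 0 < w → w ≤ r →
        ∀ A : Fin (d + 1) → EuclideanSpace ℝ (Fin d), AffineIndependent ℝ A →
          reciprocalIntegral A c r w ≤
            ENNReal.ofReal (C * (w ^ (d + 1) * r ^ (d ^ 2 - d - 1)))) ∧
    (∃ κ : ℝ, 0 < κ ∧
      ∀ (c : EuclideanSpace ℝ (Fin d)) (r w : ℝ), 0 < w → w ≤ r →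
        ∃ A : Fin (d + 1) → EuclideanSpace ℝ (Fin d), AffineIndependent ℝ A ∧
          (∀ i, A i ∈ sphereShell c r w) ∧
            ENNReal.ofReal (κ * (w ^ (d + 1) * r ^ (d ^ 2 - d - 1))) ≤
              reciprocalIntegral A c r w) := by
  obtain ⟨n, rfl⟩ : ∃ n, d = n + 1 := ⟨d - 1, by omega⟩
  have hn : 2 ≤ n := by omega
  obtain ⟨C, hC, hCle⟩ := exists_reciprocalIntegral_le hn
  exact ⟨⟨C, hC, fun c r w hw hwr A _ => hCle c r w hw hwr A⟩, exists_le_reciprocalIntegral hn⟩
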